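/- Regard $\mathbb{Z}^d$ as a graph in which $u\sim v$ when $\|u-v\|_1=1$. A \emph{domain} is a non-empty finite set $\Lambda\subset\mathbb{Z}^d$ such that both $\Lambda$ and $\mathbb{Z}^d\setminus\Lambda$ are connected. Its internal vertex-boundary $\partial_\bullet\Lambda$ is the set of vertices of $\Lambda$ adjacent to a vertex outside $\Lambda$. The (ferromagnetic) Ising model on $\Lambda$ at inverse temperature $\beta\ge 0$ is the probability measure on $\Omega=\{-1,1\}^{\Lambda}$ given by $$\mathbb{P}_{\beta,\Lambda}(\sigma)=\frac{1}{Z_{\beta,\Lambda}}\exp\Big[\beta\sum_{\{u,v\}\subset\Lambda,\ u\sim v}\sigma(u)\sigma(v)\Big],$$ where the sum counts each edge once and $Z_{\beta,\Lambda}$ is the normalizing constant. Let $\mathbb{P}_{\beta,\Lambda,+}$ be $\mathbb{P}_{\beta,\Lambda}$ conditioned on the event that $\sigma(u)=1$ for all $u\in\partial_\bullet\Lambda$. \textbf{Theorem (ordering at low temperature for the Ising model).} There exists an absolute constant $C>0$ such that for all dimensions $d\ge 2$, all inverse temperatures $\beta\ge \frac{C\log d}{d}$, all domains $\Lambda\subset\mathbb{Z}^d$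 and all $v\in\Lambda$, $$\mathbb{P}_{\beta,\Lambda,+}(\sigma(v)=-1)\le\frac14 .$$ -/

import Mathlib

noncomputable section

/-- The nearest-neighbour graph on `ℤ^d`: two vertices are adjacent when their `ℓ¹`-distance is
`1`. -/
def latticeGraph (d : ℕ) : SimpleGraph (Fin d → ℤ) where
  Adj u v := ∑ i, |u i - v i| = 1
  symm.symm u v h := by simpa only [abs_sub_comm] using h
  loopless.irrefl u h := by simp at h

instance (d : ℕ) : DecidableRel (latticeGraph d).Adj :=
  fun u v => inferInstanceAs (Decidable (∑ i, |u i - v i| = 1))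

/-- A domain: a finite non-empty set of vertices of `ℤ^d` which is connected and has a connected
complement (`SimpleGraph.Connected` includes non-emptiness). -/
structure IsLatticeDomain {d : ℕ} (Λ : Finset (Fin d → ℤ)) : Prop where
  connected : ((latticeGraph d).induce (Λ : Set (Fin d → ℤ))).Connected
  compl_connected : ((latticeGraph d).induce (Λ : Set (Fin d → ℤ))ᶜ).Connected

/-- The internal vertex-boundary: the vertices of `Λ` adjacent to a vertex outside `Λ`. -/
def internalBoundary {d : ℕ} (Λ : Finset (Fin d → ℤ)) : Set (Fin d → ℤ) :=
  {v | v ∈ Λ ∧ ∃ w, (latticeGraph d).Adj v w ∧ w ∉ Λ}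

/-- Every set of spins is measurable, so that every event on configurations is measurable. -/
instance instDiscreteSpin : DiscreteMeasurableSpace ℤˣ where
  forall_measurableSet s :=
    ⟨Units.val '' s, .of_discrete, Set.preimage_image_eq s Units.val_injective⟩

/-- Spin configurations on `Λ`; the spins live in `ℤˣ = {-1, 1}`. -/
abbrev SpinConfig {d : ℕ} (Λ : Finset (Fin d → ℤ)) : Type := Λ → ℤˣ

/-- The sum of `σ(u) σ(v)` over the edges `{u, v}` of `ℤ^d` with both endpoints in `Λ`, each edge
being counted once. -/
def isingInteraction {d : ℕ} (Λ : Finset (Fin d → ℤ)) (σ : SpinConfig Λ) : ℝ :=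
  ∑ e ∈ ((latticeGraph d).comap (Subtype.val : Λ → Fin d → ℤ)).edgeFinset,
    Sym2.lift ⟨fun u v => (((σ u : ℤ) : ℝ) * ((σ v : ℤ) : ℝ)), fun _ _ => mul_comm _ _⟩ e

/-- The Boltzmann weight of a configuration in the ferromagnetic Ising model. -/
def isingWeight {d : ℕ} (β : ℝ) (Λ : Finset (Fin d → ℤ)) (σ : SpinConfig Λ) : ℝ :=
  Real.exp (β * isingInteraction Λ σ)

/-- The partition function. -/
def isingPartition {d : ℕ} (β : ℝ) (Λ : Finset (Fin d → ℤ)) : ℝ :=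
  ∑ σ : SpinConfig Λ, isingWeight β Λ σ

/-- The Ising model on `Λ` at inverse temperature `β`: the measure giving mass
`isingWeight β Λ σ / isingPartition β Λ` to each configuration `σ`. -/
def isingMeasure {d : ℕ} (β : ℝ) (Λ : Finset (Fin d → ℤ)) :
    MeasureTheory.Measure (SpinConfig Λ) :=
  ∑ σ : SpinConfig Λ,
    ENNReal.ofReal (isingWeight β Λ σ / isingPartition β Λ) • MeasureTheory.Measure.dirac σ

/-- The configurations equal to `1` on the internal vertex-boundary of `Λ`. -/
def plusConfigs {d : ℕ} (Λ : Finset (Fin d → ℤ)) : Set (SpinConfig Λ) :=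
  {σ | ∀ v : Λ, (v : Fin d → ℤ) ∈ internalBoundary Λ → σ v = 1}

/-- The Ising model with `+` boundary conditions: the Ising model conditioned on the event
`plusConfigs Λ`. -/
def isingPlusMeasure {d : ℕ} (β : ℝ) (Λ : Finset (Fin d → ℤ)) :
    MeasureTheory.Measure (SpinConfig Λ) :=
  ProbabilityTheory.cond (isingMeasure β Λ) (plusConfigs Λ)

theorem isingPartition_pos {d : ℕ} (β : ℝ) (Λ : Finset (Fin d → ℤ)) :
    0 < isingPartition β Λ :=
  Finset.sum_pos (fun _ _ => Real.exp_pos _) Finset.univ_nonempty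

instance isingMeasure_isProbabilityMeasure {d : ℕ} (β : ℝ) (Λ : Finset (Fin d → ℤ)) :
    MeasureTheory.IsProbabilityMeasure (isingMeasure β Λ) where
  measure_univ := by
    have hZ := isingPartition_pos β Λ
    simp only [isingMeasure, MeasureTheory.Measure.coe_finsetSum, Finset.sum_apply,
      MeasureTheory.Measure.smul_apply, MeasureTheory.measure_univ, smul_eq_mul, mul_one]
    rw [← ENNReal.ofReal_sum_of_nonneg
      (fun σ _ => div_nonneg (show 0 ≤ isingWeight β Λ σ from (Real.exp_pos _).le) hZ.le), ← Finset.sum_div]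
    rw [← isingPartition, div_self hZ.ne', ENNReal.ofReal_one]

theorem isingMeasure_plusConfigs_ne_zero {d : ℕ} (β : ℝ) (Λ : Finset (Fin d → ℤ)) :
    isingMeasure β Λ (plusConfigs Λ) ≠ 0 := by
  have hZ := isingPartition_pos β Λ
  have h1 : (fun _ => 1 : SpinConfig Λ) ∈ plusConfigs Λ := fun _ _ => rfl
  simp only [isingMeasure, MeasureTheory.Measure.coe_finsetSum, Finset.sum_apply,
    MeasureTheory.Measure.smul_apply, smul_eq_mul]
  intro h
  have h2 := (Finset.sum_eq_zero_iff.mp h) (fun _ => 1) (Finset.mem_univ _)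
  rw [MeasureTheory.Measure.dirac_apply_of_mem h1, mul_one, ENNReal.ofReal_eq_zero] at h2
  exact absurd h2 (not_le.mpr (div_pos (Real.exp_pos _) hZ))

/-- The conditioning event has positive probability, so the conditioned model is a probability
measure. -/
instance isingPlusMeasure_isProbabilityMeasure {d : ℕ} (β : ℝ) (Λ : Finset (Fin d → ℤ)) :
    MeasureTheory.IsProbabilityMeasure (isingPlusMeasure β Λ) :=
  ProbabilityTheory.cond_isProbabilityMeasure (isingMeasure_plusConfigs_ne_zero β Λ)

end

/-! Peierls' argument, with a contour count that gains a factor `d`. If `v` carries a minus spin,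
filling the holes of its minus cluster gives a region `A`, connected with connected complement,
whose `N = boundarySize A` boundary edges all lead from minus to plus. Flipping `A` raises the
interaction by at least `2N` and keeps the plus boundary, so (`exists_contour`) the probability in
question is at most the sum of `exp(-2βN)` over such regions containing `v`.

Listing all `N` faces one by one, with order `d` choices for each, would need `β` of order `log d`.
Instead only the faces orthogonal to one axis `e_i` are listed. They determine `A`
(`dirBoundary_injective`), and for the best `i` there are at most `N / d` of them. They are linked
(`exists_link`): any proper part is joined to the rest by at most one unit step followed by a move
along `e_i`, whose length is paid for by boundary edges beside it (`sum_faceCharge_le`). Hence all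
of them are visited by fewer than `2N / d` steps of total vertical length at most `8N`
(`exists_linkTrace_eq`). The generating function of such itineraries is a geometric series, small
once `βd` is a large multiple of `log d` (`sum_exp_boundarySize_le`). -/

/-- The `i`-th standard basis vector of `ℤ^d`. -/
def unitVec {d : ℕ} (i : Fin d) : Fin d → ℤ := Pi.single i 1

@[simp] theorem unitVec_same {d : ℕ} (i : Fin d) : unitVec i i = 1 := by simp [unitVec]

theorem unitVec_of_ne {d : ℕ} {i j : Fin d} (h : j ≠ i) : unitVec i j = 0 := by
  simp [unitVec, h]

theorem latticeGraph_adj_iff {d : ℕ} {u w : Fin d → ℤ} :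
    (latticeGraph d).Adj u w ↔ ∃ i, w = u + unitVec i ∨ u = w + unitVec i := by
  constructor
  · intro h
    have h : ∑ i, |u i - w i| = 1 := h
    have hne : ∃ i, u i ≠ w i := by
      by_contra! hc
      simp [hc] at h
    obtain ⟨i, hi⟩ := hne
    rw [← Finset.add_sum_erase _ _ (Finset.mem_univ i)] at h
    have h1 : 1 ≤ |u i - w i| := Int.one_le_abs (sub_ne_zero.mpr hi)
    have h2 : 0 ≤ ∑ j ∈ Finset.univ.erase i, |u j - w j| :=
      Finset.sum_nonneg fun _ _ => abs_nonneg _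
    have h3 : ∑ j ∈ Finset.univ.erase i, |u j - w j| = 0 := by omega
    have h4 : ∀ j, j ≠ i → u j = w j := by
      intro j hj
      have := (Finset.sum_eq_zero_iff_of_nonneg fun _ _ => abs_nonneg _).mp h3 j (by simp [hj])
      exact sub_eq_zero.mp (abs_eq_zero.mp this)
    refine ⟨i, ?_⟩
    have h5 : |u i - w i| = 1 := by omega
    rcases (abs_eq zero_le_one).mp h5 with h6 | h6
    · right
      funext j
      by_cases hj : j = i
      · subst hj; simp; omega
      · simp [unitVec_of_ne hj, h4 j hj]
    · left
      funext j
      by_cases hj : j = i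
      · subst hj; simp; omega
      · simp [unitVec_of_ne hj, h4 j hj]
  · rintro ⟨i, rfl | rfl⟩ <;> show ∑ j, |_| = 1
    · rw [Finset.sum_eq_single i] <;> simp +contextual [unitVec_of_ne]
    · rw [Finset.sum_eq_single i] <;> simp +contextual [unitVec_of_ne]

/-- Connectivity of a set of vertices, in terms of locally constant predicates. -/
def IsAdjConnected {d : ℕ} (s : Set (Fin d → ℤ)) : Prop :=
  ∀ G : (Fin d → ℤ) → Prop,
    (∀ x ∈ s, ∀ y ∈ s, (latticeGraph d).Adj x y → (G x ↔ G y)) →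
      ∀ x ∈ s, ∀ y ∈ s, (G x ↔ G y)

/-- The edges `{u, u + e_i}` with exactly one endpoint in `A`, represented by `u`. -/
def dirBoundary {d : ℕ} (A : Finset (Fin d → ℤ)) (i : Fin d) : Finset (Fin d → ℤ) :=
  (A ∪ A.image (· - unitVec i)).filter fun u => ¬(u ∈ A ↔ u + unitVec i ∈ A)

theorem mem_dirBoundary {d : ℕ} {A : Finset (Fin d → ℤ)} {i : Fin d} {u : Fin d → ℤ} :
    u ∈ dirBoundary A i ↔ ¬(u ∈ A ↔ u + unitVec i ∈ A) := by
  simp only [dirBoundary, Finset.mem_filter, Finset.mem_union, Finset.mem_image,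
    and_iff_right_iff_imp]
  intro h
  by_cases hu : u ∈ A
  · exact Or.inl hu
  · exact Or.inr ⟨u + unitVec i, by tauto, by simp⟩

/-- The size of the edge boundary. -/
def boundarySize {d : ℕ} (A : Finset (Fin d → ℤ)) : ℕ := ∑ i, (dirBoundary A i).card

/-! ### Marked flips of two parallel sequences -/

/-- A sequence of propositions changes its truth value at `n`. -/
def FlipsAt (a : ℕ → Prop) (n : ℕ) : Prop := ¬(a n ↔ a (n + 1))

/-- Two sequences with a marking of their flips: if flips that are consecutive within a stretch
where the sequences disagree are marked alike, then the markings balance wherever the two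
sequences agree. -/
theorem iff_of_linked_flips (a g : Bool → ℕ → Prop)
    (ha : ∀ c, ¬a c 0) (hg : ∀ c, ¬g c 0)
    (hsub : ∀ c n, FlipsAt (g c) n → FlipsAt (a c) n)
    (H : ∀ c c' h h', h ≤ h' → (h = h' → c ≠ c') →
      (∀ k, h < k → k ≤ h' → ¬(a true k ↔ a false k)) →
      (∀ k, h < k → k < h' → ∀ c, ¬FlipsAt (a c) k) →
      FlipsAt (a c) h → FlipsAt (a c') h' → (FlipsAt (g c) h ↔ FlipsAt (g c') h'))
    (n : ℕ) (hn : a true n ↔ a false n) : g true n ↔ g false n := by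
  -- Invariant: inside a stretch of disagreement, the most recent flip `h` is marked exactly when
  -- the markings are out of balance. The flip ending the stretch is marked like it and so restores
  -- the balance.
  have key : ∀ n, ((a true n ↔ a false n) → (g true n ↔ g false n)) ∧
      (¬(a true n ↔ a false n) → ∃ h < n, (∀ k, h < k → k ≤ n → ¬(a true k ↔ a false k)) ∧
        (∀ k, h < k → k < n → ∀ c, ¬FlipsAt (a c) k) ∧
        ∃ c, FlipsAt (a c) h ∧ (FlipsAt (g c) h ↔ ¬(g true n ↔ g false n))) := by
    intro n
    induction n with
    | zero => exact ⟨fun _ => by simp [hg], fun h => absurd (by simp [ha]) h⟩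
    | succ n ih =>
      have st := hsub true n
      have sf := hsub false n
      have hb : FlipsAt (a true) n → FlipsAt (a false) n →
          (FlipsAt (g true) n ↔ FlipsAt (g false) n) :=
        H true false n n le_rfl (by simp) (by intros; omega) (by intros; omega)
      by_cases e : a true n ↔ a false n
      · have e1 := ih.1 e
        refine ⟨?_, ?_⟩
        · clear H ha hg hsub
          grind [FlipsAt]
        · intro h1
          refine ⟨n, by omega, ?_, by intros; omega, ?_⟩
          · intro k hk1 hk2
            obtain rfl : k = n + 1 := by omega
            exact h1
          · by_cases hf : FlipsAt (a true) n
            · refine ⟨true, hf, ?_⟩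
              clear H ha hg hsub
              grind [FlipsAt]
            · refine ⟨false, ?_, ?_⟩ <;>
              · clear H ha hg hsub
                grind [FlipsAt]
      · obtain ⟨h, hlt, h1, h2, c, hc, hgc⟩ := ih.2 e
        have l1 : ∀ c', FlipsAt (a c') n → (FlipsAt (g c) h ↔ FlipsAt (g c') n) := fun c' hf =>
          H c c' h n hlt.le (by omega) h1 h2 hc hf
        have lt := l1 true
        have lf := l1 false
        refine ⟨?_, ?_⟩
        · clear H ha hg hsub
          grind [FlipsAt]
        · intro e'
          have hnew : ∀ k, n < k → k ≤ n + 1 → ¬(a true k ↔ a false k) := by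
            intro k hk1 hk2
            obtain rfl : k = n + 1 := by omega
            exact e'
          by_cases hf : FlipsAt (a true) n
          · refine ⟨n, by omega, hnew, by intros; omega, true, hf, ?_⟩
            clear H ha hg hsub
            grind [FlipsAt]
          · have hf' : ¬FlipsAt (a false) n := by
              clear H ha hg hsub
              grind [FlipsAt]
            refine ⟨h, by omega, ?_, ?_, c, hc, ?_⟩
            · intro k hk1 hk2
              rcases Nat.lt_or_ge n k with hk | hk
              · exact hnew k hk hk2
              · exact h1 k hk1 hk
            · intro k hk1 hk2 c'
              rcases Nat.lt_or_ge k n with hk | hk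
              · exact h2 k hk1 hk c'
              · obtain rfl : k = n := by omega
                cases c' <;> assumption
            · clear H ha hg hsub
              grind [FlipsAt]
  exact (key n).1 hn

/-! ### Charging vertical distances to boundary edges -/

/-- The vector `± e_j`. -/
def dirVec {d : ℕ} (jb : Fin d × Bool) : Fin d → ℤ :=
  if jb.2 then unitVec jb.1 else -unitVec jb.1

/-- The point `a` is reached from the face `g` of `D` by moving along `e_i` (upwards if `s`,
otherwise downwards), with no further face of `D` in between. -/
def IsNearest {d : ℕ} (D : Finset (Fin d → ℤ)) (i : Fin d) (s : Bool) (g a : Fin d → ℤ) : Prop :=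
  -- A face `g` stands for the edge from `g` to `g + e_i`, so the points above it start at `g + e_i`
  -- and those below it at `g` itself.
  ∃ k : ℕ, (a = if s then g + ((k : ℤ) + 1) • unitVec i else g - (k : ℤ) • unitVec i) ∧
    ∀ k' < k, (if s then g + ((k' : ℤ) + 1) • unitVec i else g - ((k' : ℤ) + 1) • unitVec i) ∉ D

/-- Of two faces from which the same point is reached, the farther one would meet the nearer one on
the way. -/
theorem IsNearest.unique {d : ℕ} {D : Finset (Fin d → ℤ)} {i : Fin d} {s : Bool}
    {g g' a : Fin d → ℤ} (hg : g ∈ D) (hg' : g' ∈ D) (h : IsNearest D i s g a)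
    (h' : IsNearest D i s g' a) : g = g' := by
  obtain ⟨k, hk, hk'⟩ := h
  obtain ⟨l, hl, hl'⟩ := h'
  cases s
  · simp only [Bool.false_eq_true, if_false] at *
    rcases lt_trichotomy k l with hkl | hkl | hkl
    · exfalso
      refine hl' (l - k - 1) (by omega) ?_
      convert hg using 1
      have : g = g' - (l : ℤ) • unitVec i + (k : ℤ) • unitVec i := by rw [← hl, hk]; abel
      rw [this, show ((l - k - 1 : ℕ) : ℤ) = l - k - 1 by omega]
      module
    · subst hkl
      have := hk.symm.trans hl
      simpa using this
    · exfalso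
      refine hk' (k - l - 1) (by omega) ?_
      convert hg' using 1
      have : g' = g - (k : ℤ) • unitVec i + (l : ℤ) • unitVec i := by rw [← hk, hl]; abel
      rw [this, show ((k - l - 1 : ℕ) : ℤ) = k - l - 1 by omega]
      module
  · simp only [if_true] at *
    rcases lt_trichotomy k l with hkl | hkl | hkl
    · exfalso
      refine hl' (l - k - 1) (by omega) ?_
      convert hg using 1
      have : g = g' + ((l : ℤ) + 1) • unitVec i - ((k : ℤ) + 1) • unitVec i := by
        rw [← hl, hk]; abel
      rw [this, show ((l - k - 1 : ℕ) : ℤ) = l - k - 1 by omega]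
      module
    · subst hkl
      have := hk.symm.trans hl
      simpa using this
    · exfalso
      refine hk' (k - l - 1) (by omega) ?_
      convert hg' using 1
      have : g' = g + ((k : ℤ) + 1) • unitVec i - ((l : ℤ) + 1) • unitVec i := by
        rw [← hk, hl]; abel
      rw [this, show ((k - l - 1 : ℕ) : ℤ) = k - l - 1 by omega]
      module

/-- The boundary edges of `A`, each with an orientation and a choice of up or down. -/
def boundaryTokens {d : ℕ} (A : Finset (Fin d → ℤ)) :
    Finset ((Bool × Bool) × (Σ _ : Fin d, Fin d → ℤ)) :=
  Finset.univ ×ˢ (Finset.univ.sigma fun j => dirBoundary A j)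

/-- The starting point of an oriented boundary edge. -/
def tokenPoint {d : ℕ} (τ : (Bool × Bool) × (Σ _ : Fin d, Fin d → ℤ)) : Fin d → ℤ :=
  if τ.1.2 then τ.2.2 else τ.2.2 + unitVec τ.2.1

open Classical in
/-- The number of oriented boundary edges to which the face `g` is nearest along `e_i`. -/
noncomputable def faceCharge {d : ℕ} (A : Finset (Fin d → ℤ)) (i : Fin d) (g : Fin d → ℤ) : ℕ :=
  ((boundaryTokens A).filter fun τ =>
    IsNearest (dirBoundary A i) i τ.1.1 g (tokenPoint τ)).card

/-- Double counting: each boundary edge yields four tokens (two orientations, up or down), and each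
token has at most one nearest face. -/
theorem sum_faceCharge_le {d : ℕ} (A : Finset (Fin d → ℤ)) (i : Fin d) :
    ∑ g ∈ dirBoundary A i, faceCharge A i g ≤ 4 * boundarySize A := by
  classical
  have h1 : ∑ g ∈ dirBoundary A i, faceCharge A i g =
      ∑ τ ∈ boundaryTokens A, ((dirBoundary A i).filter fun g =>
        IsNearest (dirBoundary A i) i τ.1.1 g (tokenPoint τ)).card :=
    Finset.sum_card_bipartiteAbove_eq_sum_card_bipartiteBelow
      (fun g τ => IsNearest (dirBoundary A i) i τ.1.1 g (tokenPoint τ))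
  have h2 : (boundaryTokens A).card = 4 * boundarySize A := by
    simp [boundaryTokens, boundarySize]
  rw [h1, ← h2, Finset.card_eq_sum_ones]
  refine Finset.sum_le_sum fun τ _ => Finset.card_le_one.mpr ?_
  intro g hg g' hg'
  rw [Finset.mem_filter] at hg hg'
  exact hg.2.unique hg.1 hg'.1 hg'.2

/-- Where a column next to `g` disagrees with a neighbouring column, every height contributes a
boundary edge between the two. Until another face intervenes, all these edges are charged to `g`. -/
theorem le_faceCharge {d : ℕ} {A : Finset (Fin d → ℤ)} {i : Fin d} (s : Bool) {g : Fin d → ℤ}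
    (jb : Fin d × Bool) {m : ℕ} (z : ℕ → Fin d → ℤ)
    (hz : ∀ k, z k = if s then g + ((k : ℤ) + 1) • unitVec i else g - (k : ℤ) • unitVec i)
    (hb : ∀ k < m, ¬(z k ∈ A ↔ z k + dirVec jb ∈ A))
    (hD : ∀ k, k + 1 < m →
      (if s then g + ((k : ℤ) + 1) • unitVec i else g - ((k : ℤ) + 1) • unitVec i) ∉
        dirBoundary A i) :
    m ≤ faceCharge A i g := by
  classical
  obtain ⟨j, b⟩ := jb
  have hinj : Function.Injective z := by
    intro k l hkl
    have := congrFun hkl i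
    rw [hz, hz] at this
    cases s <;> simp at this <;> omega
  have : (Finset.range m).card ≤ faceCharge A i g := by
    refine Finset.card_le_card_of_injOn
      (fun k => ((s, b), ⟨j, if b then z k else z k - unitVec j⟩)) ?_ ?_
    · intro k hk
      have hk : k < m := by simpa using hk
      have hbk := hb k hk
      simp only [Finset.mem_coe, Finset.mem_filter]
      refine ⟨?_, k, ?_, fun k' hk' => hD k' (by omega)⟩
      · cases b <;> simp [boundaryTokens, mem_dirBoundary, dirVec] at hbk ⊢
        · rw [sub_eq_add_neg]; tauto
        · exact hbk
      · rw [← hz]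
        cases b <;> simp [tokenPoint]
    · intro k _ l _ hkl
      cases b <;> simp at hkl <;> exact hinj hkl
  simpa using this

/-! ### The faces orthogonal to one axis are linked -/

/-- The parity of the number of elements of `P` below a point in its column. -/
theorem exists_column_parity {d : ℕ} (P : Finset (Fin d → ℤ)) (i : Fin d) :
    ∃ G : (Fin d → ℤ) → Prop, (∀ x, x ∈ P ↔ ¬(G x ↔ G (x + unitVec i))) ∧
      ∃ B : ℤ, ∀ x : Fin d → ℤ, x i ≤ B → ¬G x := by
  classical
  refine ⟨fun x => Odd (P.filter fun p => (∀ j, j ≠ i → p j = x j) ∧ p i < x i).card, ?_, ?_⟩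
  · intro x
    beta_reduce
    by_cases hx : x ∈ P
    · have : (P.filter fun p => (∀ j, j ≠ i → p j = (x + unitVec i) j) ∧ p i < (x + unitVec i) i) =
          insert x (P.filter fun p => (∀ j, j ≠ i → p j = x j) ∧ p i < x i) := by
        ext p
        simp only [Finset.mem_filter, Finset.mem_insert, Pi.add_apply, unitVec_same]
        constructor
        · rintro ⟨hp, h1, h2⟩
          rcases lt_or_eq_of_le (Int.lt_add_one_iff.mp h2) with h3 | h3
          · exact Or.inr ⟨hp, fun j hj => by simpa [unitVec_of_ne hj] using h1 j hj, h3⟩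
          · left
            funext j
            by_cases hj : j = i
            · rw [hj, h3]
            · simpa [unitVec_of_ne hj] using h1 j hj
        · rintro (rfl | ⟨hp, h1, h2⟩)
          · exact ⟨hx, fun j hj => by simp [unitVec_of_ne hj], by omega⟩
          · exact ⟨hp, fun j hj => by simpa [unitVec_of_ne hj] using h1 j hj, by omega⟩
      rw [this, Finset.card_insert_of_notMem (by simp), Nat.odd_add_one]
      tauto
    · have : (P.filter fun p => (∀ j, j ≠ i → p j = (x + unitVec i) j) ∧ p i < (x + unitVec i) i) =
          (P.filter fun p => (∀ j, j ≠ i → p j = x j) ∧ p i < x i) := by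
        ext p
        simp only [Finset.mem_filter, Pi.add_apply, unitVec_same]
        constructor
        · rintro ⟨hp, h1, h2⟩
          rcases lt_or_eq_of_le (Int.lt_add_one_iff.mp h2) with h3 | h3
          · exact ⟨hp, fun j hj => by simpa [unitVec_of_ne hj] using h1 j hj, h3⟩
          · exfalso
            apply hx
            convert hp using 1
            funext j
            by_cases hj : j = i
            · rw [hj, h3]
            · simpa [unitVec_of_ne hj] using (h1 j hj).symm
        · rintro ⟨hp, h1, h2⟩
          exact ⟨hp, fun j hj => by simpa [unitVec_of_ne hj] using h1 j hj, by omega⟩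
      rw [this]
      tauto
  · obtain ⟨B, hB⟩ := (P.image fun p => p i).bddBelow
    refine ⟨B, fun x hx => ?_⟩
    beta_reduce
    rw [Finset.filter_eq_empty_iff.mpr]
    · simp
    · rintro p hp ⟨-, h⟩
      have := hB (Finset.mem_coe.mpr (Finset.mem_image_of_mem _ hp))
      omega

/-- A displacement: either nothing or one of the vectors `± e_j`, followed by a move up or down. -/
abbrev LinkStep (d : ℕ) : Type := Option (Fin d × Bool) × Bool × ℕ

/-- The displacement vector, where up and down refer to `e_i`. -/
def LinkStep.vec {d : ℕ} (i : Fin d) (t : LinkStep d) : Fin d → ℤ :=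
  t.1.elim 0 dirVec + (if t.2.1 then (t.2.2 : ℤ) else -(t.2.2 : ℤ)) • unitVec i

/-- The opposite displacement. -/
def LinkStep.neg {d : ℕ} (t : LinkStep d) : LinkStep d :=
  (t.1.map fun jb => (jb.1, !jb.2), !t.2.1, t.2.2)

theorem dirVec_not {d : ℕ} (jb : Fin d × Bool) : dirVec (jb.1, !jb.2) = -dirVec jb := by
  obtain ⟨j, b⟩ := jb
  cases b <;> simp [dirVec]

theorem LinkStep.vec_neg {d : ℕ} (i : Fin d) (t : LinkStep d) : t.neg.vec i = -t.vec i := by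
  obtain ⟨o, s, m⟩ := t
  cases o <;> cases s <;> simp [LinkStep.vec, LinkStep.neg, dirVec_not] <;> abel

theorem dirVec_apply_of_ne {d : ℕ} {jb : Fin d × Bool} {i : Fin d} (h : jb.1 ≠ i) :
    dirVec jb i = 0 := by
  obtain ⟨j, b⟩ := jb
  cases b <;> simp [dirVec, unitVec_of_ne (Ne.symm h)]

theorem exists_lt_apply {d : ℕ} (A : Finset (Fin d → ℤ)) (i : Fin d) :
    ∃ B : ℤ, ∀ x : Fin d → ℤ, x i ≤ B → x ∉ A := by
  obtain ⟨B, hB⟩ := (A.image fun p => p i).bddBelow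
  refine ⟨B - 1, fun x hx hxA => ?_⟩
  have := hB (Finset.mem_coe.mpr (Finset.mem_image_of_mem _ hxA))
  omega

/-- If a set `P` of faces is closed under links, then the parity of the number of its faces below
a point is the same for neighbours in different columns unless a boundary edge separates them. -/
theorem column_parity_iff_of_closed {d : ℕ} {A P : Finset (Fin d → ℤ)} {i : Fin d}
    (hP : P ⊆ dirBoundary A i)
    (hlink : ∀ p ∈ dirBoundary A i, ∀ q ∈ dirBoundary A i, ∀ t : LinkStep d,
      q = p + t.vec i → t.2.2 ≤ faceCharge A i p → t.2.2 ≤ faceCharge A i q → (p ∈ P ↔ q ∈ P))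
    {G : (Fin d → ℤ) → Prop} (hG : ∀ x, x ∈ P ↔ ¬(G x ↔ G (x + unitVec i)))
    {B : ℤ} (hB : ∀ x : Fin d → ℤ, x i ≤ B → ¬G x)
    {jb : Fin d × Bool} (hj : jb.1 ≠ i) {x : Fin d → ℤ} (hx : x ∈ A ↔ x + dirVec jb ∈ A) :
    G x ↔ G (x + dirVec jb) := by
  obtain ⟨B', hB'⟩ := exists_lt_apply A i
  obtain ⟨K, hK, hK'⟩ : ∃ K : ℕ, x i - K ≤ B ∧ x i - K ≤ B' :=
    ⟨(x i - B).toNat + (x i - B').toNat, by omega, by omega⟩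
  -- The columns of `x` (`c = true`) and of its neighbour, started at a depth `K` where both lie
  -- outside `A` and have even parity; height `K` is the level of `x`.
  set X : Bool → ℕ → Fin d → ℤ := fun c h =>
    x - (K : ℤ) • unitVec i + (if c then 0 else dirVec jb) + (h : ℤ) • unitVec i with hX
  set jbc : Bool → Fin d × Bool := fun c => if c then jb else (jb.1, !jb.2) with hjbc
  have hXs : ∀ c h, X c (h + 1) = X c h + unitVec i := by
    intro c h
    simp only [hX]
    push_cast
    module
  have hXc : ∀ c h, X c h + dirVec (jbc c) = X (!c) h := by
    intro c h
    cases c <;> simp [hX, hjbc, dirVec_not] <;> abel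
  have hXd : ∀ c h h', h ≤ h' → X c h' = X c h + ((h' - h : ℕ) : ℤ) • unitVec i := by
    intro c h h' hh
    simp only [hX]
    push_cast [hh]
    module
  have hX0 : ∀ c, X c 0 i = x i - K := by
    intro c
    cases c <;> simp [hX, dirVec_apply_of_ne hj]
  have hfa : ∀ c h, FlipsAt (fun h => X c h ∈ A) h ↔ X c h ∈ dirBoundary A i := by
    intro c h
    simp only [FlipsAt, mem_dirBoundary, hXs]
  have hfg : ∀ c h, FlipsAt (fun h => G (X c h)) h ↔ X c h ∈ P := by
    intro c h
    simp only [FlipsAt, hG, hXs]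
  have hXK : X true K = x := by simp [hX]
  have hXK' : X false K = x + dirVec jb := by
    simp only [hX, Bool.false_eq_true, if_false]
    abel
  have := iff_of_linked_flips (fun c h => X c h ∈ A) (fun c h => G (X c h))
    (fun c => hB' _ (by rw [hX0]; exact hK')) (fun c => hB _ (by rw [hX0]; exact hK))
    (fun c n h => (hfa c n).mpr (hP ((hfg c n).mp h))) ?_ K (by simpa only [hXK, hXK'] using hx)
  · simpa only [hXK, hXK'] using this
  intro c c' h h' hh hcc hbd hfl hc hc'
  rw [hfg, hfg]
  rw [hfa] at hc hc'
  have hbd' : ∀ c k, h < k → k ≤ h' → ¬(X c k ∈ A ↔ X c k + dirVec (jbc c) ∈ A) := by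
    intro c k hk hk'
    have := hbd k hk hk'
    rw [hXc]
    cases c <;> simp only [Bool.not_true, Bool.not_false] <;> tauto
  have hfl' : ∀ c k, h < k → k < h' → X c k ∉ dirBoundary A i := fun c k hk hk' => by
    rw [← hfa]
    exact hfl k hk hk' c
  -- The columns disagree at the `h' - h` heights in `(h, h']`. These heights are charged to the
  -- lower face looking up and to the upper face looking down.
  refine hlink _ hc _ hc' (if c = c' then none else some (jbc c), true, h' - h) ?_ ?_ ?_
  · rw [hXd c' h h' hh]
    by_cases hcc' : c = c'
    · simp [LinkStep.vec, hcc']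
    · have : X c' h = X c h + dirVec (jbc c) := by
        rw [hXc]
        cases c <;> cases c' <;> simp at hcc' ⊢
      rw [this]
      simp [LinkStep.vec, hcc']
      abel
  · refine le_faceCharge true (jbc c) (fun k => X c (h + k + 1)) ?_ ?_ ?_
    · intro k
      rw [hXd c h (h + k + 1) (by omega)]
      simp [add_assoc]
    · intro k hk
      exact hbd' c _ (by omega) (by dsimp only at hk; omega)
    · intro k hk
      convert hfl' c (h + k + 1) (by omega) (by dsimp only at hk; omega) using 1
      rw [hXd c h (h + k + 1) (by omega)]
      simp [add_assoc]
  · have hsub : ∀ k ≤ h', X c' (h' - k) = X c' h' - (k : ℤ) • unitVec i := by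
      intro k hk
      rw [hXd c' (h' - k) h' (by omega), show h' - (h' - k) = k by omega]
      abel
    refine le_faceCharge false (jbc c')
      (fun k => X c' h' - (k : ℤ) • unitVec i) (fun k => by simp) ?_ ?_
    · intro k hk
      dsimp only at hk
      rw [← hsub k (by omega)]
      exact hbd' c' _ (by omega) (by omega)
    · intro k hk
      dsimp only at hk
      convert hfl' c' (h' - (k + 1)) (by omega) (by omega) using 1
      rw [hsub _ (by omega)]
      simp

/-- The faces orthogonal to `e_i` of a region which is connected and has a connected complement
form a linked set. -/
theorem exists_link {d : ℕ} {A P : Finset (Fin d → ℤ)} (hA : IsAdjConnected (A : Set (Fin d → ℤ)))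
    (hA' : IsAdjConnected (A : Set (Fin d → ℤ))ᶜ) {i : Fin d} (hP : P ⊆ dirBoundary A i)
    (hne : P.Nonempty) (hne' : P ≠ dirBoundary A i) :
    ∃ p ∈ P, ∃ q ∈ dirBoundary A i, q ∉ P ∧ ∃ t : LinkStep d,
      q = p + t.vec i ∧ t.2.2 ≤ faceCharge A i q := by
  by_contra! hc
  -- Bounding the length by the charges of both ends makes the relation symmetric: whichever end
  -- lies in `P`, the step or its reverse is excluded by `hc`.
  have hlink : ∀ p ∈ dirBoundary A i, ∀ q ∈ dirBoundary A i, ∀ t : LinkStep d,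
      q = p + t.vec i → t.2.2 ≤ faceCharge A i p → t.2.2 ≤ faceCharge A i q →
        (p ∈ P ↔ q ∈ P) := by
    intro p hp q hq t ht h1 h2
    by_cases hpP : p ∈ P <;> by_cases hqP : q ∈ P
    · tauto
    · exact absurd h2 (not_le.mpr (hc p hpP q hq hqP t ht))
    · refine absurd h1 (not_le.mpr (hc q hqP p hp hpP t.neg ?_))
      rw [LinkStep.vec_neg, ht]
      abel
    · tauto
  obtain ⟨G, hG, B, hB⟩ := exists_column_parity P i
  have hup : ∀ x j, (x ∈ A ↔ x + unitVec j ∈ A) → (G x ↔ G (x + unitVec j)) := by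
    intro x j hx
    by_cases hj : j = i
    · subst hj
      by_contra h
      exact mem_dirBoundary.mp (hP ((hG x).mpr h)) hx
    · exact column_parity_iff_of_closed hP hlink hG hB (jb := (j, true)) hj hx
  have hadj : ∀ x y, (x ∈ A ↔ y ∈ A) → (latticeGraph d).Adj x y → (G x ↔ G y) := by
    intro x y hxy h
    obtain ⟨j, rfl | rfl⟩ := latticeGraph_adj_iff.mp h
    · exact hup x j hxy
    · exact (hup y j hxy.symm).symm
  obtain ⟨B', hB'⟩ := exists_lt_apply A i
  have hout : ∀ x, x ∉ A → ¬G x := by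
    intro x hx
    set y : Fin d → ℤ := fun _ => min B B'
    have hy : y ∉ A := hB' y (min_le_right _ _)
    rw [hA' G (fun x hx y hy => hadj x y (iff_of_false hx hy)) x hx y hy]
    exact hB y (min_le_left _ _)
  have hin : ∀ x ∈ A, ∀ y ∈ A, (G x ↔ G y) :=
    hA G (fun x hx y hy => hadj x y (iff_of_true hx hy))
  obtain ⟨p, hp⟩ := hne
  obtain ⟨q, hq, hqP⟩ := Finset.exists_of_ssubset (Finset.ssubset_iff_subset_ne.mpr ⟨hP, hne'⟩)
  have hp1 := mem_dirBoundary.mp (hP hp)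
  have hp2 := (hG p).mp hp
  have hq1 := mem_dirBoundary.mp hq
  have hq2 := mt (hG q).mpr hqP
  have a1 := hout p
  have a2 := hout (p + unitVec i)
  have b1 := hout q
  have b2 := hout (q + unitVec i)
  have c1 := hin p
  have c2 := hin (p + unitVec i)
  clear hlink hc hin hout hadj hup hA hA' hG hB hB' hne' hP
  -- `G` fails off `A` and is constant on `A`. A face in `P` makes it hold on `A`; then `G` changes
  -- across every face, including `q`, which forces `q ∈ P`.
  grind

/-! ### Encoding a region by an itinerary through its faces -/

/-- The set of points visited by a sequence of steps from a given point. -/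
def linkTrace {d : ℕ} (i : Fin d) : (Fin d → ℤ) → List (LinkStep d) → Finset (Fin d → ℤ)
  | g, [] => {g}
  | g, t :: l => insert g (linkTrace i (g + t.vec i) l)

/-- The total length of the vertical moves in a sequence of steps. -/
def linkCost {d : ℕ} (l : List (LinkStep d)) : ℕ := (l.map fun t => t.2.2).sum

/-- On reaching `p`, step out by `t` and straight back; the rest of the itinerary is unaffected. -/
theorem exists_detour {d : ℕ} {i : Fin d} (t : LinkStep d) {p : Fin d → ℤ}
    (l : List (LinkStep d)) : ∀ g, p ∈ linkTrace i g l →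
      ∃ l', l'.length = l.length + 2 ∧ linkCost l' = linkCost l + 2 * t.2.2 ∧
        linkTrace i g l' = insert (p + t.vec i) (linkTrace i g l) := by
  have hback : ∀ p : Fin d → ℤ, p + t.vec i + t.neg.vec i = p := by
    intro p
    rw [LinkStep.vec_neg]
    abel
  induction l with
  | nil =>
    intro g hg
    obtain rfl : p = g := by simpa [linkTrace] using hg
    refine ⟨[t, t.neg], by simp, by simp [linkCost, LinkStep.neg]; omega, ?_⟩
    simp only [linkTrace, hback]
    ext x
    simp
  | cons t₀ l ih =>
    intro g hg
    by_cases hpg : p = g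
    · subst hpg
      refine ⟨t :: t.neg :: t₀ :: l, by simp, by simp [linkCost, LinkStep.neg]; omega, ?_⟩
      simp only [linkTrace, hback]
      ext x
      simp
    · have hg' : p ∈ linkTrace i (g + t₀.vec i) l := by simpa [linkTrace, hpg] using hg
      obtain ⟨l', h1, h2, h3⟩ := ih _ hg'
      refine ⟨t₀ :: l', by simp [h1], ?_, ?_⟩
      · simp [linkCost] at h2 ⊢
        omega
      · simp only [linkTrace, h3]
        rw [Finset.insert_comm]

/-- The faces orthogonal to `e_i` can be visited by a short sequence of steps of small cost. -/
theorem exists_linkTrace_eq {d : ℕ} {A : Finset (Fin d → ℤ)}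
    (hA : IsAdjConnected (A : Set (Fin d → ℤ)))
    (hA' : IsAdjConnected (A : Set (Fin d → ℤ))ᶜ) {i : Fin d} {g : Fin d → ℤ}
    (hg : g ∈ dirBoundary A i) :
    ∃ l : List (LinkStep d), l.length + 2 = 2 * (dirBoundary A i).card ∧
      linkTrace i g l = dirBoundary A i ∧ linkCost l ≤ 8 * boundarySize A := by
  -- Faces are added one at a time by detours, each paid for by the charge of the new face. No
  -- charge is used twice, so the total cost is at most `2 * 4 * boundarySize A`.
  have key : ∀ n < (dirBoundary A i).card, ∃ l : List (LinkStep d), l.length = 2 * n ∧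
      linkTrace i g l ⊆ dirBoundary A i ∧ (linkTrace i g l).card = n + 1 ∧
      g ∈ linkTrace i g l ∧
      linkCost l ≤ 2 * ∑ q ∈ linkTrace i g l, faceCharge A i q := by
    intro n
    induction n with
    | zero => exact fun _ => ⟨[], by simp [linkTrace, linkCost, hg]⟩
    | succ n ih =>
      intro hn
      obtain ⟨l, h1, h2, h3, h4, h5⟩ := ih (by omega)
      obtain ⟨p, hp, q, hq, hqP, t, rfl, ht⟩ := exists_link hA hA' h2 ⟨g, h4⟩ (by
        intro h
        rw [h] at h3
        omega)
      obtain ⟨l', e1, e2, e3⟩ := exists_detour t l g hp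
      refine ⟨l', by omega, ?_, ?_, ?_, ?_⟩
      · rw [e3]
        exact Finset.insert_subset hq h2
      · rw [e3, Finset.card_insert_of_notMem hqP, h3]
      · rw [e3]
        exact Finset.mem_insert_of_mem h4
      · rw [e3, Finset.sum_insert hqP]
        omega
  have hpos : 0 < (dirBoundary A i).card := Finset.card_pos.mpr ⟨g, hg⟩
  obtain ⟨l, h1, h2, h3, h4, h5⟩ := key ((dirBoundary A i).card - 1) (by omega)
  have h6 : linkTrace i g l = dirBoundary A i := Finset.eq_of_subset_of_card_le h2 (by omega)
  refine ⟨l, by omega, h6, ?_⟩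
  have := sum_faceCharge_le A i
  rw [h6] at h5
  omega

/-- A finite set is determined by its faces orthogonal to `e_i`. -/
theorem dirBoundary_injective {d : ℕ} (i : Fin d) :
    Function.Injective fun A : Finset (Fin d → ℤ) => dirBoundary A i := by
  intro A A' h
  obtain ⟨B, hB⟩ := exists_lt_apply A i
  obtain ⟨B', hB'⟩ := exists_lt_apply A' i
  ext x
  obtain ⟨K, hK, hK'⟩ : ∃ K : ℕ, x i - K ≤ B ∧ x i - K ≤ B' :=
    ⟨(x i - B).toNat + (x i - B').toNat, by omega, by omega⟩
  have key : ∀ n : ℕ, x - (K : ℤ) • unitVec i + (n : ℤ) • unitVec i ∈ A ↔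
      x - (K : ℤ) • unitVec i + (n : ℤ) • unitVec i ∈ A' := by
    intro n
    induction n with
    | zero => exact iff_of_false (hB _ (by simpa using hK)) (hB' _ (by simpa using hK'))
    | succ n ih =>
      have h1 := Finset.ext_iff.mp h (x - (K : ℤ) • unitVec i + (n : ℤ) • unitVec i)
      simp only [mem_dirBoundary] at h1
      have h2 : x - (K : ℤ) • unitVec i + ((n + 1 : ℕ) : ℤ) • unitVec i =
          x - (K : ℤ) • unitVec i + (n : ℤ) • unitVec i + unitVec i := by
        push_cast
        module
      rw [h2]
      tauto
  simpa using key K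

/-- The first face above a point of `A`, in the direction `e_i`, is at distance less than the
size of the boundary. -/
theorem exists_face_above {d : ℕ} (hd : 2 ≤ d) {A : Finset (Fin d → ℤ)} {v : Fin d → ℤ}
    (hv : v ∈ A) (i : Fin d) :
    ∃ m : ℕ, m ≤ boundarySize A ∧ v + (m : ℤ) • unitVec i ∈ dirBoundary A i := by
  classical
  have hex : ∀ (j : Fin d) (u : Fin d → ℤ), ∃ m : ℕ, u + (m : ℤ) • unitVec j ∉ A := by
    intro j u
    by_contra! hc
    have hinj : Function.Injective fun m : ℕ => (⟨u + (m : ℤ) • unitVec j, hc m⟩ : A) := by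
      intro m n h
      have := congrFun (Subtype.ext_iff.mp h) j
      simpa using this
    exact not_injective_infinite_finite _ hinj
  have hface : ∀ (j : Fin d) (u : Fin d → ℤ), u ∈ A → ∃ m : ℕ,
      (∀ k ≤ m, u + (k : ℤ) • unitVec j ∈ A) ∧ u + (m : ℤ) • unitVec j ∈ dirBoundary A j := by
    intro j u hu
    have h0 : Nat.find (hex j u) ≠ 0 := by
      intro h
      have := Nat.find_spec (hex j u)
      rw [h] at this
      simp [hu] at this
    have hlt : ∀ k < Nat.find (hex j u), u + (k : ℤ) • unitVec j ∈ A := fun k hk => by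
      simpa using Nat.find_min (hex j u) hk
    refine ⟨Nat.find (hex j u) - 1, fun k hk => hlt k (by omega), ?_⟩
    rw [mem_dirBoundary]
    have h1 := hlt (Nat.find (hex j u) - 1) (by omega)
    have h2 := Nat.find_spec (hex j u)
    have h3 : u + ((Nat.find (hex j u) - 1 : ℕ) : ℤ) • unitVec j + unitVec j =
        u + ((Nat.find (hex j u) : ℕ) : ℤ) • unitVec j := by
      rw [Nat.cast_sub (by omega)]
      push_cast
      module
    rw [h3]
    tauto
  obtain ⟨m, hm, hmD⟩ := hface i v hv
  refine ⟨m, ?_, hmD⟩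
  -- The `m + 1` points from `v` up to the face lie in `A`, and the rays from them along a second
  -- axis `e_j` leave `A` through distinct faces.
  have : Nontrivial (Fin d) := Fin.nontrivial_iff_two_le.mpr hd
  obtain ⟨j, hj⟩ := exists_ne i
  choose f _ hf using fun k : Fin (m + 1) =>
    hface j (v + ((k : ℕ) : ℤ) • unitVec i) (hm k (by omega))
  have hcard : (Finset.univ : Finset (Fin (m + 1))).card ≤ (dirBoundary A j).card := by
    refine Finset.card_le_card_of_injOn _ (fun k _ => hf k) ?_
    intro k _ l _ h
    have := congrFun h i
    simp [unitVec_of_ne hj.symm] at this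
    omega
  have hle : (dirBoundary A j).card ≤ boundarySize A :=
    Finset.single_le_sum (f := fun j => (dirBoundary A j).card) (fun _ _ => Nat.zero_le _)
      (Finset.mem_univ j)
  simp at hcard
  omega

/-! ### The contour sum -/

open scoped ENNReal

theorem ENNReal.tsum_fin_prod {α : Type*} (f : α → ℝ≥0∞) (n : ℕ) :
    ∑' x : Fin n → α, ∏ k, f (x k) = (∑' a, f a) ^ n := by
  induction n with
  | zero => simp
  | succ n ih =>
    rw [← (Fin.consEquiv fun _ : Fin (n + 1) => α).tsum_eq, ENNReal.tsum_prod']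
    simp only [Fin.consEquiv_apply, Fin.prod_univ_succ, Fin.cons_zero, Fin.cons_succ,
      ENNReal.tsum_mul_left, ENNReal.tsum_mul_right, ih]
    rw [pow_succ, mul_comm]

/-- A geometric series over the length of the list. Truncated subtraction makes the right side `⊤`
when the sum of `f` is at least `1`. -/
theorem ENNReal.tsum_list_prod {α : Type*} (f : α → ℝ≥0∞) :
    ∑' l : List α, (l.map f).prod = (1 - ∑' a, f a)⁻¹ := by
  rw [← List.equivSigmaTuple.symm.tsum_eq, ENNReal.tsum_sigma', ← ENNReal.tsum_geometric]
  refine tsum_congr fun n => ?_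
  rw [← ENNReal.tsum_fin_prod]
  refine tsum_congr fun x => ?_
  simp [List.equivSigmaTuple, List.map_ofFn, List.prod_ofFn]

theorem exists_mul_card_dirBoundary_le {d : ℕ} (hd : 0 < d) (A : Finset (Fin d → ℤ)) :
    ∃ i, d * (dirBoundary A i).card ≤ boundarySize A := by
  by_contra! hc
  have : NeZero d := ⟨hd.ne'⟩
  have h := Finset.sum_lt_sum_of_nonempty (s := Finset.univ) Finset.univ_nonempty
    fun i _ => hc i
  rw [← Finset.mul_sum] at h
  simp [boundarySize] at h

/-- The sum over regions containing a given point of a weight decaying with the boundary size. -/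
theorem sum_weight_le_tsum {d : ℕ} (hd : 2 ≤ d) {v : Fin d → ℤ}
    {F : Finset (Finset (Fin d → ℤ))}
    (hF : ∀ A ∈ F, v ∈ A ∧ IsAdjConnected (A : Set (Fin d → ℤ)) ∧
      IsAdjConnected (A : Set (Fin d → ℤ))ᶜ) (w : Finset (Fin d → ℤ) → ℝ≥0∞) (r s : ℝ≥0∞)
    (hw : ∀ A ∈ F, ∀ m n c, d * (n + 2) ≤ 2 * boundarySize A → m ≤ boundarySize A →
      c ≤ 8 * boundarySize A → w A ≤ s ^ 2 * r ^ m * (s ^ n * r ^ c)) :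
    ∑ A ∈ F, w A ≤ s ^ 2 * (d * (1 - r)⁻¹) *
      (1 - s * ((2 * d + 1 : ℕ) * (2 * (1 - r)⁻¹)))⁻¹ := by
  -- The code records the axis, the height of the starting face above `v`, and the itinerary. The
  -- factor `s ^ 2` makes up for the itinerary being two steps shorter than twice the number of
  -- faces.
  have hcode : ∀ A : F, ∃ c : Fin d × ℕ × List (LinkStep d),
      linkTrace c.1 (v + (c.2.1 : ℤ) • unitVec c.1) c.2.2 = dirBoundary A.1 c.1 ∧
      w A ≤ s ^ 2 * r ^ c.2.1 * (c.2.2.map fun t => s * r ^ t.2.2).prod := by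
    intro ⟨A, hAF⟩
    obtain ⟨hv, hA, hA'⟩ := hF A hAF
    obtain ⟨i, hi⟩ := exists_mul_card_dirBoundary_le (by omega) A
    obtain ⟨m, hm, hmD⟩ := exists_face_above hd hv i
    obtain ⟨l, h1, h2, h3⟩ := exists_linkTrace_eq hA hA' hmD
    refine ⟨(i, m, l), h2, ?_⟩
    have hprod : ∀ l : List (LinkStep d), (l.map fun t => s * r ^ t.2.2).prod =
        s ^ l.length * r ^ linkCost l := by
      intro l
      induction l with
      | nil => simp [linkCost]
      | cons t l ih =>
        simp only [List.map_cons, List.prod_cons, ih, linkCost, List.sum_cons, List.length_cons]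
        ring
    rw [hprod]
    refine hw A hAF _ _ _ ?_ hm h3
    rw [h1]
    linarith
  choose c hc hcw using hcode
  have hinj : Function.Injective c := by
    intro A A' h
    have h1 := hc A
    have h2 := hc A'
    rw [h, h2] at h1
    exact Subtype.ext (dirBoundary_injective _ h1.symm)
  calc ∑ A ∈ F, w A = ∑ A : F, w A := (Finset.sum_coe_sort F w).symm
    _ ≤ ∑ A : F, s ^ 2 * r ^ (c A).2.1 * ((c A).2.2.map fun t => s * r ^ t.2.2).prod :=
        Finset.sum_le_sum fun A _ => hcw A
    _ = ∑' A : F, s ^ 2 * r ^ (c A).2.1 * ((c A).2.2.map fun t => s * r ^ t.2.2).prod :=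
        (tsum_fintype _).symm
    _ ≤ ∑' x : Fin d × ℕ × List (LinkStep d),
          s ^ 2 * r ^ x.2.1 * (x.2.2.map fun t => s * r ^ t.2.2).prod :=
        ENNReal.tsum_comp_le_tsum_of_injective hinj
          fun x => s ^ 2 * r ^ x.2.1 * (x.2.2.map fun t => s * r ^ t.2.2).prod
    _ = _ := by
        simp only [ENNReal.tsum_prod', ENNReal.tsum_mul_left, ENNReal.tsum_mul_right,
          ENNReal.tsum_list_prod, ENNReal.tsum_geometric, tsum_fintype, Finset.sum_const,
          Finset.card_univ, Fintype.card_fin, Fintype.card_option, Fintype.card_prod,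
          Fintype.card_bool, nsmul_eq_mul]
        push_cast
        ring_nf

theorem ENNReal.inv_natCast_mul_le {n k m : ℕ} (hn : 0 < n) (hm : 0 < m) (h : n * k ≤ m) :
    (m : ℝ≥0∞)⁻¹ * k ≤ (n : ℝ≥0∞)⁻¹ := by
  have hn' : (n : ℝ≥0∞) ≠ 0 := by exact_mod_cast hn.ne'
  have hm' : (m : ℝ≥0∞) ≠ 0 := by exact_mod_cast hm.ne'
  rw [mul_comm, ← div_eq_mul_inv, ENNReal.div_le_iff hm' (ENNReal.natCast_ne_top _), mul_comm,
    ← div_eq_mul_inv, ENNReal.le_div_iff_mul_le (Or.inl hn') (Or.inl (ENNReal.natCast_ne_top _))]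
  rw [mul_comm]
  exact_mod_cast h

/-- The contour sum in the Peierls argument. -/
theorem sum_exp_boundarySize_le {d : ℕ} (hd : 2 ≤ d) {β : ℝ}
    (hβ : 100 * Real.log d / d ≤ β) {v : Fin d → ℤ} {F : Finset (Finset (Fin d → ℤ))}
    (hF : ∀ A ∈ F, v ∈ A ∧ IsAdjConnected (A : Set (Fin d → ℤ)) ∧
      IsAdjConnected (A : Set (Fin d → ℤ))ᶜ) :
    ∑ A ∈ F, ENNReal.ofReal (Real.exp (-(2 * β * boundarySize A))) ≤ 1 / 4 := by
  have hd' : (2 : ℝ) ≤ d := by exact_mod_cast hd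
  have hlog : 100 * Real.log d ≤ β * d := (div_le_iff₀ (by linarith)).mp hβ
  have hlog2 : (1 : ℝ) / 2 ≤ Real.log d :=
    le_trans (by linarith [Real.log_two_gt_d9]) (Real.log_le_log (by norm_num) hd')
  have hβd : 16 ≤ β * d := by linarith
  have hβ0 : 0 < β := by
    by_contra! h
    nlinarith
  -- With `N = boundarySize A`, the steps use at most `βN / 2` of the exponent, the starting height
  -- `βN / 16` and the vertical moves `βN / 2`; together this is below the available `2βN`.
  set r : ℝ≥0∞ := ENNReal.ofReal (Real.exp (-(β / 16))) with hr
  set s : ℝ≥0∞ := ENNReal.ofReal (Real.exp (-(β * d / 4))) with hs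
  have hG : (1 - r)⁻¹ ≤ (d + 1 : ℕ) := by
    rw [ENNReal.inv_le_iff_inv_le]
    have h1 : Real.exp (-(β / 16)) ≤ d / (d + 1) := by
      rw [Real.exp_neg, inv_le_comm₀ (Real.exp_pos _) (by positivity), inv_div]
      have h2 := Real.add_one_le_exp (β / 16)
      refine le_trans ?_ h2
      rw [div_le_iff₀ (by linarith)]
      nlinarith
    have h3 : ((d + 1 : ℕ) : ℝ≥0∞)⁻¹ = ENNReal.ofReal (1 - d / (d + 1)) := by
      rw [show (1 : ℝ) - d / (d + 1) = ((d + 1 : ℕ) : ℝ)⁻¹ by push_cast; field_simp; ring,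
        ENNReal.ofReal_inv_of_pos (by positivity), ENNReal.ofReal_natCast]
    rw [h3, hr, ← ENNReal.ofReal_one, ← ENNReal.ofReal_sub _ (Real.exp_pos _).le]
    exact ENNReal.ofReal_le_ofReal (by linarith)
  -- The exponent `25` is `100 / 4`.
  have hs1 : s ≤ ((d ^ 25 : ℕ) : ℝ≥0∞)⁻¹ := by
    rw [← ENNReal.ofReal_natCast, ← ENNReal.ofReal_inv_of_pos (by positivity)]
    refine ENNReal.ofReal_le_ofReal ?_
    rw [Real.exp_neg]
    refine inv_anti₀ (by positivity) ?_
    push_cast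
    rw [← Real.exp_log (show (0 : ℝ) < d by linarith), ← Real.exp_nat_mul, Real.exp_le_exp,
      Real.exp_log (by linarith)]
    push_cast
    linarith
  have hpow : 32 * d ^ 2 ≤ d ^ 25 := by
    calc 32 * d ^ 2 = 2 ^ 5 * d ^ 2 := by norm_num
      _ ≤ d ^ 5 * d ^ 2 := by gcongr
      _ = d ^ 7 := by ring
      _ ≤ d ^ 25 := Nat.pow_le_pow_right (by omega) (by norm_num)
  have hd0 : 0 < d ^ 25 := by positivity
  have hκ : s * ((2 * d + 1 : ℕ) * (2 * (1 - r)⁻¹)) ≤ 2⁻¹ := by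
    calc s * ((2 * d + 1 : ℕ) * (2 * (1 - r)⁻¹))
        ≤ ((d ^ 25 : ℕ) : ℝ≥0∞)⁻¹ * ((2 * d + 1 : ℕ) * (2 * (d + 1 : ℕ))) := by gcongr
      _ = ((d ^ 25 : ℕ) : ℝ≥0∞)⁻¹ * ((2 * d + 1) * (2 * (d + 1)) : ℕ) := by push_cast; ring
      _ ≤ ((2 : ℕ) : ℝ≥0∞)⁻¹ := ENNReal.inv_natCast_mul_le (by norm_num) hd0 (by nlinarith)
      _ = 2⁻¹ := by norm_num
  have hκ' : (1 - s * ((2 * d + 1 : ℕ) * (2 * (1 - r)⁻¹)))⁻¹ ≤ 2 := by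
    rw [ENNReal.inv_le_iff_inv_le]
    refine le_trans ?_ (tsub_le_tsub_left hκ 1)
    rw [ENNReal.one_sub_inv_two]
  have hs2 : s ≤ 1 := by
    rw [hs, ENNReal.ofReal_le_one, Real.exp_le_one_iff]
    linarith
  refine (sum_weight_le_tsum hd hF _ r s ?_).trans ?_
  · intro A _ m n c h1 h2 h3
    rw [hr, hs, ← ENNReal.ofReal_pow (Real.exp_pos _).le, ← ENNReal.ofReal_pow (Real.exp_pos _).le,
      ← ENNReal.ofReal_pow (Real.exp_pos _).le, ← ENNReal.ofReal_pow (Real.exp_pos _).le,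
      ← ENNReal.ofReal_mul (by positivity), ← ENNReal.ofReal_mul (by positivity),
      ← ENNReal.ofReal_mul (by positivity)]
    refine ENNReal.ofReal_le_ofReal ?_
    simp only [← Real.exp_nat_mul, ← Real.exp_add]
    rw [Real.exp_le_exp]
    have h1' : (d : ℝ) * (n + 2) ≤ 2 * boundarySize A := by exact_mod_cast h1
    have h2' : (m : ℝ) ≤ boundarySize A := by exact_mod_cast h2
    have h3' : (c : ℝ) ≤ 8 * boundarySize A := by exact_mod_cast h3
    push_cast
    nlinarith [mul_le_mul_of_nonneg_left h1' hβ0.le, mul_le_mul_of_nonneg_left h2' hβ0.le,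
      mul_le_mul_of_nonneg_left h3' hβ0.le]
  · calc s ^ 2 * (d * (1 - r)⁻¹) * (1 - s * ((2 * d + 1 : ℕ) * (2 * (1 - r)⁻¹)))⁻¹
        ≤ s * (d * (d + 1 : ℕ)) * 2 := by
          gcongr
          calc s ^ 2 = s * s := sq s
            _ ≤ s * 1 := by gcongr
            _ = s := mul_one s
      _ ≤ ((d ^ 25 : ℕ) : ℝ≥0∞)⁻¹ * (d * (d + 1 : ℕ)) * 2 := by gcongr
      _ = ((d ^ 25 : ℕ) : ℝ≥0∞)⁻¹ * (d * (d + 1) * 2 : ℕ) := by push_cast; ring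
      _ ≤ ((4 : ℕ) : ℝ≥0∞)⁻¹ := ENNReal.inv_natCast_mul_le (by norm_num) hd0 (by nlinarith)
      _ = 1 / 4 := by norm_num

/-! ### Contours around a minus spin and the flipping map -/

theorem isAdjConnected_of_connected {d : ℕ} {s : Set (Fin d → ℤ)}
    (h : ((latticeGraph d).induce s).Connected) : IsAdjConnected s := by
  intro G hG x hx y hy
  obtain ⟨p⟩ := h.preconnected ⟨x, hx⟩ ⟨y, hy⟩
  have key : ∀ {a b : s}, ((latticeGraph d).induce s).Walk a b → (G a ↔ G b) := by
    intro a b p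
    induction p with
    | nil => rfl
    | cons hab _ ih => exact (hG _ (Subtype.prop _) _ (Subtype.prop _) hab).trans ih
  exact key p

/-- The cluster of `v` in a set of vertices of a domain avoiding the internal boundary, with its
holes filled in, is connected with connected complement, and its boundary edges lead out of the
set. -/
theorem exists_filled_cluster {d : ℕ} {Λ : Finset (Fin d → ℤ)} (hΛ : IsLatticeDomain Λ)
    {B : Set (Fin d → ℤ)} (hB : B ⊆ Λ) (hB' : ∀ x ∈ B, x ∉ internalBoundary Λ)
    {v : Fin d → ℤ} (hv : v ∈ B) (i : Fin d) :
    ∃ A : Finset (Fin d → ℤ), v ∈ A ∧ A ⊆ Λ ∧ (∀ x ∈ A, x ∉ internalBoundary Λ) ∧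
      IsAdjConnected (A : Set (Fin d → ℤ)) ∧ IsAdjConnected (A : Set (Fin d → ℤ))ᶜ ∧
      ∀ a ∈ A, ∀ b ∉ A, (latticeGraph d).Adj a b → a ∈ B ∧ b ∉ B := by
  classical
  -- `K` is the cluster of `v` and `E` is what can be reached from outside `Λ` while avoiding `K`;
  -- the filled cluster is the complement of `E`.
  set K : Set (Fin d → ℤ) :=
    {x | Relation.ReflTransGen (fun a b => (latticeGraph d).Adj a b ∧ b ∈ B) v x} with hK
  set E : Set (Fin d → ℤ) := {x | ∃ y, y ∉ Λ ∧
    Relation.ReflTransGen (fun a b => (latticeGraph d).Adj a b ∧ b ∉ K) y x} with hE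
  have hKB : K ⊆ B := by
    intro x hx
    rcases Relation.ReflTransGen.cases_tail hx with rfl | ⟨_, _, h⟩
    · exact hv
    · exact h.2
  have hvK : v ∈ K := Relation.ReflTransGen.refl
  have hEK : ∀ x ∈ E, x ∉ K := by
    rintro x ⟨y, hy, hyx⟩ hxK
    rcases Relation.ReflTransGen.cases_tail hyx with rfl | ⟨_, _, h⟩
    · exact hy (hB (hKB hxK))
    · exact h.2 hxK
  have hEΛ : ∀ x ∉ Λ, x ∈ E := fun x hx => ⟨x, hx, Relation.ReflTransGen.refl⟩
  have hEadj : ∀ x ∈ E, ∀ y ∉ K, (latticeGraph d).Adj x y → y ∈ E := by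
    rintro x ⟨z, hz, hzx⟩ y hy hxy
    exact ⟨z, hz, hzx.tail ⟨hxy, hy⟩⟩
  have hmem : ∀ x, x ∈ Λ.filter (fun x => x ∉ E) ↔ x ∉ E := by
    intro x
    rw [Finset.mem_filter, and_iff_right_iff_imp]
    exact fun h => by_contra fun h' => h (hEΛ x h')
  have hbd : ∀ a ∉ E, ∀ b ∈ E, (latticeGraph d).Adj a b → a ∈ K := fun a ha b hb hab =>
    by_contra fun h => ha (hEadj b hb a h hab.symm)
  refine ⟨Λ.filter fun x => x ∉ E, ?_, Finset.filter_subset _ _, ?_, ?_, ?_, ?_⟩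
  · rw [hmem]
    exact fun h => hEK v h hvK
  · intro x hx hxb
    rw [hmem] at hx
    obtain ⟨w, hxw, hw⟩ := hxb.2
    exact hB' x (hKB (hbd x hx w (hEΛ w hw) hxw)) hxb
  · have hKE : ∀ x ∈ K, x ∉ E := fun x hx h => hEK x h hx
    intro G hG
    simp only [Finset.mem_coe, hmem] at hG ⊢
    have hGK : ∀ x ∈ K, (G x ↔ G v) := by
      intro x hx
      induction hx with
      | refl => rfl
      | tail hvy hyz ih =>
        exact (hG _ (hKE _ (hvy.tail hyz)) _ (hKE _ hvy) hyz.1.symm).trans ih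
    -- The ray from `x` along `e_i` must leave the finite filled cluster, and the last point before
    -- it does lies in `K`.
    have hGv : ∀ x ∉ E, (G x ↔ G v) := by
      intro x hx
      by_contra hGx
      have key : ∀ n : ℕ, x + (n : ℤ) • unitVec i ∉ E ∧
          ¬(G (x + (n : ℤ) • unitVec i) ↔ G v) := by
        intro n
        induction n with
        | zero => simpa using ⟨hx, hGx⟩
        | succ n ih =>
          have hadj : (latticeGraph d).Adj (x + (n : ℤ) • unitVec i)
              (x + ((n + 1 : ℕ) : ℤ) • unitVec i) :=
            latticeGraph_adj_iff.mpr ⟨i, Or.inl (by push_cast; module)⟩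
          have h1 : x + ((n + 1 : ℕ) : ℤ) • unitVec i ∉ E := fun h =>
            ih.2 (hGK _ (hbd _ ih.1 _ h hadj))
          exact ⟨h1, by rw [← hG _ ih.1 _ h1 hadj]; exact ih.2⟩
      have hinj : Function.Injective fun m : ℕ =>
          (⟨x + (m : ℤ) • unitVec i, (Finset.mem_filter.mp ((hmem _).mpr (key m).1)).1⟩ : Λ) := by
        intro m n h
        have := congrFun (Subtype.ext_iff.mp h) i
        simpa using this
      exact not_injective_infinite_finite _ hinj
    exact fun x hx y hy => (hGv x hx).trans (hGv y hy).symm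
  · intro G hG
    simp only [Set.mem_compl_iff, Finset.mem_coe, hmem, not_not] at hG ⊢
    have hGE : ∀ x ∈ E, ∃ y ∉ Λ, (G x ↔ G y) := by
      rintro x ⟨y, hy, hyx⟩
      refine ⟨y, hy, ?_⟩
      induction hyx with
      | refl => rfl
      | tail hyz hzw ih =>
        exact (hG _ ⟨y, hy, hyz.tail hzw⟩ _ ⟨y, hy, hyz⟩ hzw.1.symm).trans ih
    intro x hx y hy
    obtain ⟨x', hx', e1⟩ := hGE x hx
    obtain ⟨y', hy', e2⟩ := hGE y hy
    rw [e1, e2]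
    exact isAdjConnected_of_connected hΛ.compl_connected G
      (fun a ha b hb hab => hG a (hEΛ a ha) b (hEΛ b hb) hab) x' hx' y' hy'
  · intro a ha b hb hab
    rw [hmem] at ha hb
    rw [not_not] at hb
    have haK := hbd a ha b hb hab
    -- If `b` were in `B`, it would join the cluster through `a`.
    exact ⟨hKB haK, fun h => hEK b hb (haK.tail ⟨hab, h⟩)⟩

/-- The configuration obtained by flipping the spins in `A`. -/
def flipSpins {d : ℕ} {Λ : Finset (Fin d → ℤ)} (A : Finset (Fin d → ℤ)) (σ : SpinConfig Λ) :
    SpinConfig Λ := fun x => if (x : Fin d → ℤ) ∈ A then -σ x else σ x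

theorem flipSpins_injective {d : ℕ} {Λ : Finset (Fin d → ℤ)} (A : Finset (Fin d → ℤ)) :
    Function.Injective (flipSpins A : SpinConfig Λ → SpinConfig Λ) := by
  have : Function.Involutive (flipSpins A : SpinConfig Λ → SpinConfig Λ) := by
    intro σ
    funext x
    by_cases h : (x : Fin d → ℤ) ∈ A <;> simp [flipSpins, h]
  exact this.injective

theorem latticeEdge_injective {d : ℕ} :
    Function.Injective fun p : Σ _ : Fin d, Fin d → ℤ => s(p.2, p.2 + unitVec p.1) := by
  rintro ⟨i, u⟩ ⟨j, w⟩ h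
  simp only [Sym2.eq_iff] at h
  rcases h with ⟨rfl, h⟩ | ⟨h1, h2⟩
  · have hij : i = j := by
      by_contra hij
      have := congrFun (add_left_cancel h) i
      simp [unitVec_of_ne hij] at this
    rw [hij]
  · exfalso
    rw [h1, add_assoc, add_eq_left] at h2
    have := congrFun h2 i
    by_cases hij : i = j
    · subst hij; simp at this
    · simp [unitVec_of_ne hij] at this

/-- Flipping a region surrounded by unsatisfied edges increases the interaction. -/
theorem isingInteraction_add_le_flipSpins {d : ℕ} {Λ A : Finset (Fin d → ℤ)} {σ : SpinConfig Λ}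
    (hA : ∀ a ∈ A, ∀ b ∉ A, (latticeGraph d).Adj a b →
      ∃ (ha : a ∈ Λ) (hb : b ∈ Λ), σ ⟨a, ha⟩ = -1 ∧ σ ⟨b, hb⟩ = 1) :
    isingInteraction Λ σ + 2 * boundarySize A ≤ isingInteraction Λ (flipSpins A σ) := by
  classical
  rw [← le_sub_iff_add_le', isingInteraction, isingInteraction, ← Finset.sum_sub_distrib]
  set Γ := (latticeGraph d).comap (Subtype.val : Λ → Fin d → ℤ)
  set f : Sym2 Λ → ℝ := fun e =>
    Sym2.lift ⟨fun u v => (((flipSpins A σ u : ℤ) : ℝ) * ((flipSpins A σ v : ℤ) : ℝ)),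
        fun _ _ => mul_comm _ _⟩ e -
      Sym2.lift ⟨fun u v => (((σ u : ℤ) : ℝ) * ((σ v : ℤ) : ℝ)), fun _ _ => mul_comm _ _⟩ e
  have hin : ∀ x y : Λ, (x : Fin d → ℤ) ∈ A → (y : Fin d → ℤ) ∉ A → Γ.Adj x y →
      f s(x, y) = 2 := by
    intro x y hx hy hxy
    obtain ⟨_, _, h1, h2⟩ := hA x hx y hy hxy
    simp [f, flipSpins, hx, hy, h1, h2]
    norm_num
  have hout : ∀ x y : Λ, ((x : Fin d → ℤ) ∈ A ↔ (y : Fin d → ℤ) ∈ A) → f s(x, y) = 0 := by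
    intro x y h
    by_cases hx : (x : Fin d → ℤ) ∈ A
    · simp [f, flipSpins, hx, h.mp hx]
    · simp [f, flipSpins, hx, mt h.mpr hx]
  have hpos : ∀ e ∈ Γ.edgeFinset, 0 ≤ f e := by
    intro e
    induction e using Sym2.ind with
    | _ x y =>
      intro he
      rw [SimpleGraph.mem_edgeFinset, SimpleGraph.mem_edgeSet] at he
      by_cases hx : (x : Fin d → ℤ) ∈ A <;> by_cases hy : (y : Fin d → ℤ) ∈ A
      · rw [hout x y (iff_of_true hx hy)]
      · rw [hin x y hx hy he]; norm_num
      · rw [Sym2.eq_swap, hin y x hy hx he.symm]; norm_num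
      · rw [hout x y (iff_of_false hx hy)]
  have hcard : boundarySize A ≤ (Γ.edgeFinset.filter fun e => f e = 2).card := by
    have h1 : boundarySize A = ((Finset.univ : Finset (Fin d)).sigma fun j => dirBoundary A j).card := by
      simp [boundarySize]
    rw [h1]
    refine le_trans ?_ (Finset.card_image_le (f := Sym2.map Subtype.val))
    refine Finset.card_le_card_of_injOn _ ?_ latticeEdge_injective.injOn
    rintro ⟨i, u⟩ hu
    have hu : ¬(u ∈ A ↔ u + unitVec i ∈ A) := by simpa [mem_dirBoundary] using hu
    have hadj : (latticeGraph d).Adj u (u + unitVec i) := latticeGraph_adj_iff.mpr ⟨i, Or.inl rfl⟩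
    simp only [Finset.coe_image, Set.mem_image, Finset.mem_coe, Finset.mem_filter,
      SimpleGraph.mem_edgeFinset]
    by_cases h : u ∈ A
    · obtain ⟨h1, h2, -⟩ := hA u h (u + unitVec i) (by tauto) hadj
      exact ⟨s(⟨u, h1⟩, ⟨_, h2⟩), ⟨hadj, hin _ _ h (by tauto) hadj⟩, rfl⟩
    · obtain ⟨h1, h2, -⟩ := hA (u + unitVec i) (by tauto) u h hadj.symm
      refine ⟨s(⟨u, h2⟩, ⟨_, h1⟩), ⟨hadj, ?_⟩, rfl⟩
      rw [Sym2.eq_swap]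
      exact hin _ _ (by tauto) h hadj.symm
  calc (2 : ℝ) * boundarySize A
      ≤ 2 * (Γ.edgeFinset.filter fun e => f e = 2).card := by gcongr
    _ = ∑ e ∈ Γ.edgeFinset.filter (fun e => f e = 2), f e := by
        rw [Finset.sum_congr rfl fun e he => (Finset.mem_filter.mp he).2]
        simp [mul_comm]
    _ ≤ ∑ e ∈ Γ.edgeFinset, f e :=
        Finset.sum_le_sum_of_subset_of_nonneg (Finset.filter_subset _ _) fun e he _ => hpos e he

open Classical in
theorem isingMeasure_apply {d : ℕ} (β : ℝ) (Λ : Finset (Fin d → ℤ)) (S : Set (SpinConfig Λ)) :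
    isingMeasure β Λ S = ∑ σ ∈ Finset.univ.filter (· ∈ S),
      ENNReal.ofReal (isingWeight β Λ σ / isingPartition β Λ) := by
  simp only [isingMeasure, MeasureTheory.Measure.coe_finsetSum, Finset.sum_apply,
    MeasureTheory.Measure.smul_apply, smul_eq_mul, Finset.sum_filter]
  refine Finset.sum_congr rfl fun σ _ => ?_
  rw [MeasureTheory.Measure.dirac_apply' _ .of_discrete]
  by_cases h : σ ∈ S <;> simp [h]

/-- Peierls' argument: a minus spin at `v` is surrounded by a contour. -/
theorem exists_contour {d : ℕ} (i : Fin d) {Λ : Finset (Fin d → ℤ)} (hΛ : IsLatticeDomain Λ)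
    {β : ℝ} (hβ : 0 ≤ β) {v : Λ} {σ : SpinConfig Λ} (hσ : σ ∈ plusConfigs Λ) (hv : σ v = -1) :
    ∃ A : Finset (Fin d → ℤ), ((v : Fin d → ℤ) ∈ A ∧ IsAdjConnected (A : Set (Fin d → ℤ)) ∧
      IsAdjConnected (A : Set (Fin d → ℤ))ᶜ) ∧ flipSpins A σ ∈ plusConfigs Λ ∧
      ENNReal.ofReal (isingWeight β Λ σ / isingPartition β Λ) ≤
        ENNReal.ofReal (Real.exp (-(2 * β * boundarySize A))) *
          ENNReal.ofReal (isingWeight β Λ (flipSpins A σ) / isingPartition β Λ) := by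
  have hne : (1 : ℤˣ) ≠ -1 := by decide
  obtain ⟨A, hvA, hAΛ, hAb, hA, hA', hbd⟩ := exists_filled_cluster hΛ
    (B := {x | ∃ h : x ∈ Λ, σ ⟨x, h⟩ = -1}) (fun x hx => hx.1) (by
      rintro x ⟨hx, hx'⟩ hxb
      rw [hσ ⟨x, hx⟩ hxb] at hx'
      exact hne hx') (v := v) ⟨v.2, hv⟩ i
  refine ⟨A, ⟨hvA, hA, hA'⟩, ?_, ?_⟩
  · intro x hx
    have : (x : Fin d → ℤ) ∉ A := fun h => hAb x h hx
    simp [flipSpins, this, hσ x hx]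
  · rw [← ENNReal.ofReal_mul (Real.exp_pos _).le]
    refine ENNReal.ofReal_le_ofReal ?_
    rw [← mul_div_assoc]
    refine div_le_div_of_nonneg_right ?_ (isingPartition_pos β Λ).le
    rw [isingWeight, isingWeight, ← Real.exp_add, Real.exp_le_exp]
    have := isingInteraction_add_le_flipSpins (σ := σ) (A := A) (by
      intro a ha b hb hab
      obtain ⟨⟨h1, h2⟩, h3⟩ := hbd a ha b hb hab
      -- Since `A` avoids the internal boundary, all neighbours of `a` stay in `Λ`.
      have hbΛ : b ∈ Λ := by_contra fun h => hAb a ha ⟨h1, b, hab, h⟩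
      refine ⟨h1, hbΛ, h2, ?_⟩
      rcases Int.units_eq_one_or (σ ⟨b, hbΛ⟩) with h | h
      · exact h
      · exact absurd ⟨hbΛ, h⟩ h3)
    nlinarith [mul_le_mul_of_nonneg_left this hβ]

theorem mainTheorem6 :
    ∃ C : ℝ, 0 < C ∧
      ∀ (d : ℕ), 2 ≤ d →
        ∀ (β : ℝ), C * Real.log (d : ℝ) / (d : ℝ) ≤ β →
          ∀ (Λ : Finset (Fin d → ℤ)), IsLatticeDomain Λ →
            ∀ (v : Λ),
              isingPlusMeasure β Λ {σ : SpinConfig Λ | σ v = -1} ≤ 1 / 4 := by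
  classical
  refine ⟨100, by norm_num, fun d hd β hβ Λ hΛ v => ?_⟩
  have hβ0 : 0 ≤ β := le_trans (by positivity) hβ
  have i : Fin d := ⟨0, by omega⟩
  have hex : ∀ σ : SpinConfig Λ, ∃ A : Finset (Fin d → ℤ),
      σ ∈ plusConfigs Λ ∩ {σ | σ v = -1} → _ := fun σ => by
    by_cases h : σ ∈ plusConfigs Λ ∩ {σ | σ v = -1}
    · obtain ⟨A, hA⟩ := exists_contour i hΛ hβ0 h.1 h.2
      exact ⟨A, fun _ => hA⟩
    · exact ⟨∅, fun h' => absurd h' h⟩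
  choose c hc using hex
  set T : Finset (SpinConfig Λ) :=
    Finset.univ.filter (· ∈ plusConfigs Λ ∩ {σ | σ v = -1}) with hT
  have hTc : ∀ σ ∈ T, σ ∈ plusConfigs Λ ∩ {σ | σ v = -1} := fun σ h =>
    (Finset.mem_filter.mp h).2
  -- Group the configurations by their contour. For a fixed region the flip is injective into
  -- `plusConfigs Λ`, so each group contributes at most the contour weight times the mass of that
  -- event.
  have key : isingMeasure β Λ (plusConfigs Λ ∩ {σ | σ v = -1}) ≤
      1 / 4 * isingMeasure β Λ (plusConfigs Λ) := by
    calc isingMeasure β Λ (plusConfigs Λ ∩ {σ | σ v = -1})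
        = ∑ A ∈ T.image c, ∑ σ ∈ T.filter (fun σ => c σ = A),
            ENNReal.ofReal (isingWeight β Λ σ / isingPartition β Λ) := by
          rw [isingMeasure_apply,
            Finset.sum_fiberwise_of_maps_to fun σ hσ => Finset.mem_image_of_mem c hσ]
          exact Finset.sum_congr (by ext; simp [hT]) fun _ _ => rfl
      _ ≤ ∑ A ∈ T.image c, ENNReal.ofReal (Real.exp (-(2 * β * boundarySize A))) *
            isingMeasure β Λ (plusConfigs Λ) := by
          refine Finset.sum_le_sum fun A _ => ?_
          calc _ ≤ ∑ σ ∈ T.filter (fun σ => c σ = A),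
                ENNReal.ofReal (Real.exp (-(2 * β * boundarySize A))) *
                  ENNReal.ofReal (isingWeight β Λ (flipSpins A σ) / isingPartition β Λ) := by
                refine Finset.sum_le_sum fun σ hσ => ?_
                obtain ⟨h1, rfl⟩ := Finset.mem_filter.mp hσ
                exact (hc σ (hTc σ h1)).2.2
            _ = ENNReal.ofReal (Real.exp (-(2 * β * boundarySize A))) *
                ∑ σ ∈ (T.filter fun σ => c σ = A).image (flipSpins A),
                  ENNReal.ofReal (isingWeight β Λ σ / isingPartition β Λ) := by
                rw [Finset.sum_image (flipSpins_injective A).injOn, Finset.mul_sum]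
            _ ≤ _ := by
                rw [isingMeasure_apply]
                gcongr
                intro σ' hσ'
                obtain ⟨σ, hσ, rfl⟩ := Finset.mem_image.mp hσ'
                obtain ⟨h1, rfl⟩ := Finset.mem_filter.mp hσ
                exact Finset.mem_filter.mpr ⟨Finset.mem_univ _, (hc σ (hTc σ h1)).2.1⟩
      _ ≤ 1 / 4 * isingMeasure β Λ (plusConfigs Λ) := by
          rw [← Finset.sum_mul]
          gcongr
          refine sum_exp_boundarySize_le hd hβ (v := v) fun A hA => ?_
          obtain ⟨σ, hσ, rfl⟩ := Finset.mem_image.mp hA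
          exact (hc σ (hTc σ hσ)).1
  rw [isingPlusMeasure, ProbabilityTheory.cond_apply .of_discrete]
  calc _ ≤ (isingMeasure β Λ (plusConfigs Λ))⁻¹ * (1 / 4 * isingMeasure β Λ (plusConfigs Λ)) := by
        gcongr
    _ = 1 / 4 := by
        rw [mul_left_comm, ENNReal.inv_mul_cancel (isingMeasure_plusConfigs_ne_zero β Λ)
          (MeasureTheory.measure_ne_top _ _), mul_one]
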